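/- **Definitions.** Let $m_N$ denote Lebesgue measure on $\mathbb{R}^N$, $\nu_N=m_N(B^N(0,1))$, and let $D\subset\mathbb{R}^N$ be open. For $K\ge 1$, a Lebesgue measurable function $u:D\to[-\infty,+\infty)$ is called *$K$-quasi-nearly subharmonic* on $D$ if $u^+=\max\{u,0\}\in\mathcal{L}^1_{\mathrm{loc}}(D)$ and, for every closed ball $\overline{B^N(x,r)}\subset D$ ($r>0$) and every $M\ge 0$, $$u_M(x)\le \frac{K}{\nu_N r^N}\int_{B^N(x,r)}u_M(y)\,dm_N(y),\qquad u_M:=\max\{u,-M\}+M .$$ It is called *quasi-nearly subharmonic* on $D$ if it is $K$-quasi-nearly subharmonic on $D$ for some $K\ge1$. **Theorem 4.2.** Let $\Omega$ be a domain (a nonempty connected open set) in $\mathbb{R}^{m+n}=\mathbb{R}^m\times\mathbb{R}^n$, $m\ge n\ge 2$, and let $K\ge 1$. For $y\in\mathbb{R}^n$ and $x\in\mathbb{R}^m$ put $\Omega(y)=\{x\in\mathbb{R}^m:(x,y)\in\Omega\}$ and $\Omega(x)=\{y\in\mathbb{R}^n:(x,y)\in\Omega\}$. Let $u:\Omega\to[-\infty,+\infty)$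 be a Lebesgue measurable function such that: (a) for each $y\in\mathbb{R}^n$ the function $\Omega(y)\ni x\mapsto u(x,y)$ is $K$-quasi-nearly subharmonic; (b) for each $x\in\mathbb{R}^m$ the function $\Omega(x)\ni y\mapsto u(x,y)$ is $K$-quasi-nearly subharmonic; (c) there are increasing (not necessarily strictly) functions $\varphi,\psi:[0,+\infty)\to[0,+\infty)$ and $s_0,s_1\in\mathbb{N}$ with $s_0<s_1$ such that - (c1) the inverse functions $\varphi^{-1}$ and $\psi^{-1}$ are defined on $[\min\{\varphi(s_1-s_0),\psi(s_1-s_0)\},+\infty)$, that is, each $t$ in this interval has exactly one preimage in $[0,+\infty)$ under $\varphi$ and exactly one under $\psi$; - (c2) $2K(\psi^{-1}\circ\varphi)(s-s_0)\le(\psi^{-1}\circ\varphi)(s)$ for all real $s\ge s_1$; - (c3) the function $[s_1+1,+\infty)\ni s\mapsto\dfrac{(\psi^{-1}\circ\varphi)(s+1)}{(\psi^{-1}\circ\varphi)(s)}\in\mathbb{R}$ is bounded; - (c4) $\displaystyle\int_{s_1}^{+\infty}\frac{s^{(n-1)/(m-1)}}{\varphi(s-s_0)^{1/(m-1)}}\,ds<+\infty$;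 - (c5) $\psi\circ u^+\in\mathcal{L}^1_{\mathrm{loc}}(\Omega)$. Then $u$ is quasi-nearly subharmonic in $\Omega$. -/

import Mathlib

open MeasureTheory Set Metric

/-- The point `(x, y)` of `ℝ^{m+n}`, for `x ∈ ℝ^m` and `y ∈ ℝ^n` (Euclidean norms throughout). -/
noncomputable def joinPt {m n : ℕ} (x : EuclideanSpace ℝ (Fin m)) (y : EuclideanSpace ℝ (Fin n)) :
    EuclideanSpace ℝ (Fin (m + n)) :=
  WithLp.toLp 2 (Fin.append (fun i => x i) (fun j => y j))

/-- The section `Ω(y) = {x ∈ ℝ^m : (x, y) ∈ Ω}`. -/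
def sectionAtSnd {m n : ℕ} (Ω : Set (EuclideanSpace ℝ (Fin (m + n))))
    (y : EuclideanSpace ℝ (Fin n)) : Set (EuclideanSpace ℝ (Fin m)) :=
  {x | joinPt x y ∈ Ω}

/-- The section `Ω(x) = {y ∈ ℝ^n : (x, y) ∈ Ω}`. -/
def sectionAtFst {m n : ℕ} (Ω : Set (EuclideanSpace ℝ (Fin (m + n))))
    (x : EuclideanSpace ℝ (Fin m)) : Set (EuclideanSpace ℝ (Fin n)) :=
  {y | joinPt x y ∈ Ω}

/-- The positive part `u⁺ = max {u, 0}` as a real valued function; it is only used where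
`u < +∞`. -/
noncomputable def posPartReal {α : Type*} (u : α → EReal) : α → ℝ :=
  fun x => (max (u x) 0).toReal

/-- The function `u_M = max {u, -M} + M`, which is nonnegative, with values in `[0, +∞]`. -/
noncomputable def truncShift {α : Type*} (M : ℝ) (u : α → EReal) : α → ENNReal :=
  fun x => (max (u x) ((-M : ℝ) : EReal) + (M : EReal)).toENNReal

/-- `u : D → [-∞, +∞)` is `K`-quasi-nearly subharmonic on the open set `D ⊆ ℝ^N`. Values of `u`
outside `D` play no role. Lebesgue measurability is `AEMeasurable` with respect to the Lebesgue
measure on `D`, and `volume (ball x r)` is `ν_N r^N`. -/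
structure IsQuasiNearlySubharmonicWith {N : ℕ} (K : ℝ) (u : EuclideanSpace ℝ (Fin N) → EReal)
    (D : Set (EuclideanSpace ℝ (Fin N))) : Prop where
  one_le : 1 ≤ K
  lt_top : ∀ x ∈ D, u x < ⊤
  measurable : AEMeasurable u (volume.restrict D)
  locallyIntegrable : LocallyIntegrableOn (posPartReal u) D volume
  le_mean : ∀ (x : EuclideanSpace ℝ (Fin N)) (r : ℝ), 0 < r → closedBall x r ⊆ D →
    ∀ M : ℝ, 0 ≤ M →
      truncShift M u x ≤
        ENNReal.ofReal K / volume (ball x r) * ∫⁻ y in ball x r, truncShift M u y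

/-- `u` is quasi-nearly subharmonic on `D`. -/
def IsQuasiNearlySubharmonic {N : ℕ} (u : EuclideanSpace ℝ (Fin N) → EReal)
    (D : Set (EuclideanSpace ℝ (Fin N))) : Prop :=
  ∃ K : ℝ, IsQuasiNearlySubharmonicWith K u D

/-- The inverse of `f : [0, +∞) → [0, +∞)` is defined on `T`: every `t ∈ T` has exactly one
preimage under `f` in `[0, +∞)`. -/
def InverseDefinedOn (f : ℝ → ℝ) (T : Set ℝ) : Prop :=
  ∀ t ∈ T, ∃! s : ℝ, 0 ≤ s ∧ f s = t

/-- The composition `ψ⁻¹ ∘ φ` of functions on `[0, +∞)`; it is only used at points `s` such that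
`ψ⁻¹` is defined at `φ s`. -/
noncomputable def invComp (ψ φ : ℝ → ℝ) : ℝ → ℝ :=
  fun s => Function.invFunOn ψ (Ici 0) (φ s)

/-!
The mean value inequality on balls of `ℝ^{m+n}` needs no integrability: apply the inequality in
`x` on a ball of half the radius, then the inequality in `y` under the integral sign, and use Tonelli; the product
of the two half-size balls lies in the original ball and has comparable volume
(`exists_mean_le_of_separately`). The content is the local integrability of `u⁺`, which follows
from local boundedness from above, proved by Domar's method.

**Domar's method in one group of variables** (`radius_rpow_le_of_le`). Let `v ≥ 0` satisfy the mean
value inequality with constant `K` in `ball z ρ`, and let `G k` be levels with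
`2 K G k ≤ G (k + s)` and `G (k + 1) ≤ C G k`. If `v x ≥ G (k + s)` and `v < G (k + s + 1)` on a
ball around `x`, then the part of the mean carried by `{v < G k}` accounts for at most half of
`v x`, so the set `A k = {G k ≤ v < G (k + s + 1)}` fills a fixed proportion of the ball
(`measure_le_of_le_mean`). Hence a point at level `k + s` has a point at level `k + s + 1` within
distance about `|A k|^{1/N}`. Iterating from `z`, the chain must leave `ball z ρ`, because `v` is
locally bounded; thus `ρ ≤ c ∑ |A k|^{1/N}` (`radius_le_tsum_of_le`). If a weight `J` satisfies
`J ≥ a k ^ -(N - 1)` where `v ≥ G k`, then `|A k| ≤ a k ^ (N - 1) ∫_{A k} J`; the sets `A k` overlap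
at most `s + 1` times, and Hölder's inequality gives `ρ^N ≤ c (∑ a k)^{N-1} ∫ J`.

**Two steps** (`exists_bound_of_separately_le_mean`). The levels are `G k = (ψ⁻¹ ∘ φ)(s₁ + 1 + k)`.
For fixed `x`, use the estimate in `y` with `J = ψ ∘ u⁺` and `a k = φ(s₁ + 1 + k)^{-1/(n-1)}`: if
`u(x, y) ≥ G (k + s)`, then `∫ ψ(u⁺(x, y')) dy'` is at least a constant times
`(∑_{i ≥ k} a i)^{-(n-1)}`. For fixed `y`, this lower bound makes `J(x) = ∫ ψ(u⁺(x, y')) dy'` an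
admissible weight for the estimate in `x`, with `b k` a constant times `(∑_{i ≥ k} a i)^θ`,
`θ = (n-1)/(m-1) ≤ 1`. A Hardy type inequality for antitone sequences
(`tsum_tail_rpow_le_of_antitone`) bounds `∑ b k` by a constant times `∑ (k + 1)^θ (a k)^θ`, which
is dominated by the integral in `hc4`. So the tails of `∑ b k` tend to `0`, and points at too high a
level cannot exist.
-/

open scoped ENNReal NNReal
open Filter Topology

/-! ### Domar's method for functions with a mean value inequality -/

/-- If `v` stays below `g₂` on `S`, while its value at `x` is at least `g₁` and at most `K` times
its mean over `S`, then `{g₀ ≤ v < g₂}` fills a fixed proportion of `S`: the part of `S` where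
`v < g₀` contributes at most `K g₀ ≤ g₁ / 2` to the mean. -/
theorem measure_le_of_le_mean {α : Type*} [MeasurableSpace α] {μ : Measure α} {S : Set α}
    (hSm : MeasurableSet S) (hS0 : μ S ≠ 0) (hSt : μ S ≠ ∞) {v : α → ℝ≥0∞} {x : α}
    {K C g₀ g₁ g₂ : ℝ≥0}
    (hmean : v x ≤ K / μ S * ∫⁻ y in S, v y ∂μ) (hx : g₁ ≤ v x) (h₀₁ : 2 * K * g₀ ≤ g₁)
    (h₁₂ : g₂ ≤ C * g₁) (hg₁ : 0 < g₁) (hlt : ∀ y ∈ S, v y < g₂) :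
    μ S ≤ 2 * K * C * μ ({y | g₀ ≤ v y ∧ v y < g₂} ∩ S) := by
  set A : Set α := {y | g₀ ≤ v y ∧ v y < g₂}
  have hint : ∫⁻ y in S, v y ∂μ ≤ g₀ * μ S + g₂ * μ (A ∩ S) := by
    calc ∫⁻ y in S, v y ∂μ ≤ ∫⁻ y in S, ((g₀ : ℝ≥0∞) + A.indicator (fun _ => (g₂ : ℝ≥0∞)) y) ∂μ := by
          refine setLIntegral_mono' hSm fun y hy => ?_
          by_cases h : (g₀ : ℝ≥0∞) ≤ v y
          · rw [indicator_of_mem (show y ∈ A from ⟨h, hlt y hy⟩)]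
            exact (hlt y hy).le.trans le_add_self
          · exact (not_le.1 h).le.trans le_self_add
      _ = g₀ * μ S + ∫⁻ y in S, A.indicator (fun _ => (g₂ : ℝ≥0∞)) y ∂μ := by
          rw [lintegral_add_left measurable_const, setLIntegral_const]
      _ ≤ g₀ * μ S + g₂ * μ (A ∩ S) := by
          gcongr
          refine (lintegral_indicator_const_le _ _).trans ?_
          rw [Measure.restrict_apply' hSm]
  have h1 : (g₁ : ℝ≥0∞) * μ S ≤ K * (g₀ * μ S + g₂ * μ (A ∩ S)) := by
    calc (g₁ : ℝ≥0∞) * μ S ≤ (K / μ S * (g₀ * μ S + g₂ * μ (A ∩ S))) * μ S := by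
          gcongr
          exact hx.trans (hmean.trans (by gcongr))
      _ = K * (g₀ * μ S + g₂ * μ (A ∩ S)) * ((μ S)⁻¹ * μ S) := by
          rw [div_eq_mul_inv]; ring
      _ = _ := by rw [ENNReal.inv_mul_cancel hS0 hSt, mul_one]
  have e01 : 2 * (K : ℝ≥0∞) * g₀ ≤ g₁ := by exact_mod_cast h₀₁
  have e12 : (g₂ : ℝ≥0∞) ≤ C * g₁ := by exact_mod_cast h₁₂
  have h2 : (g₁ : ℝ≥0∞) * μ S + g₁ * μ S ≤ g₁ * μ S + g₁ * (2 * K * C * μ (A ∩ S)) := by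
    calc (g₁ : ℝ≥0∞) * μ S + g₁ * μ S = 2 * (g₁ * μ S) := (two_mul _).symm
      _ ≤ 2 * (K * (g₀ * μ S + g₂ * μ (A ∩ S))) := by gcongr
      _ = (2 * K * g₀) * μ S + 2 * K * g₂ * μ (A ∩ S) := by ring
      _ ≤ g₁ * μ S + 2 * K * (C * g₁) * μ (A ∩ S) := by gcongr
      _ = _ := by ring
  have h3 := (ENNReal.add_le_add_iff_left (ENNReal.mul_ne_top ENNReal.coe_ne_top hSt)).1 h2
  exact (ENNReal.mul_le_mul_iff_right (by exact_mod_cast hg₁.ne') ENNReal.coe_ne_top).1 h3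

theorem two_pow_mul_le_of_two_mul_le {K : ℝ≥0} (hK : 1 ≤ K) {s : ℕ} {G : ℕ → ℝ≥0}
    (h : ∀ k, 2 * K * G k ≤ G (k + s)) (i : ℕ) : 2 ^ i * G 0 ≤ G (i * s) := by
  induction i with
  | zero => simp
  | succ i ih =>
    calc 2 ^ (i + 1) * G 0 = 2 * 1 * (2 ^ i * G 0) := by ring
      _ ≤ 2 * K * G (i * s) := by gcongr
      _ ≤ G (i * s + s) := h _
      _ = G ((i + 1) * s) := by rw [add_mul, one_mul]

/-- The chain argument: from a point at level `k + s` one finds a point at level `k + s + 1` within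
a distance governed by the measure of `{G k ≤ v < G (k + s + 1)}`. Since `v` is bounded on smaller
balls while `G` is unbounded, the chain starting at `z` cannot stay inside `ball z ρ`. -/
theorem radius_le_tsum_of_le {N : ℕ} (hN : 1 ≤ N) {v : EuclideanSpace ℝ (Fin N) → ℝ≥0∞}
    {z : EuclideanSpace ℝ (Fin N)} {ρ : ℝ} {K C : ℝ≥0} (hK : 1 ≤ K)
    (hmean : ∀ x r, 0 < r → closedBall x r ⊆ ball z ρ →
      v x ≤ K / volume (ball x r) * ∫⁻ y in ball x r, v y)
    (hfin : ∫⁻ y in ball z ρ, v y ≠ ∞) {s : ℕ} {G : ℕ → ℝ≥0} (hG0 : 0 < G 0) (hGm : Monotone G)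
    (hG2 : ∀ k, 2 * K * G k ≤ G (k + s)) (hGC : ∀ k, G (k + 1) ≤ C * G k) (hz : G s ≤ v z) :
    ENNReal.ofReal ρ ≤ ∑' k, (2 * K * C / volume (ball (0 : EuclideanSpace ℝ (Fin N)) 1) *
      volume ({y | G k ≤ v y ∧ v y < G (k + s + 1)} ∩ ball z ρ)) ^ (1 / (N : ℝ)) := by
  have hN0 : (N : ℝ) ≠ 0 := by positivity
  set ω := volume (ball (0 : EuclideanSpace ℝ (Fin N)) 1) with hω
  have hω0 : ω ≠ 0 := (measure_ball_pos _ _ one_pos).ne'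
  have hωt : ω ≠ ∞ := measure_ball_lt_top.ne
  have hvol : ∀ (x : EuclideanSpace ℝ (Fin N)) (r : ℝ), 0 < r →
      volume (ball x r) = ENNReal.ofReal r ^ (N : ℝ) * ω := by
    intro x r hr
    rw [Measure.addHaar_ball_of_pos _ _ hr, finrank_euclideanSpace_fin, ENNReal.ofReal_pow hr.le,
      ENNReal.rpow_natCast]
  set t : ℕ → ℝ≥0∞ := fun k => (2 * K * C / ω *
    volume ({y | G k ≤ v y ∧ v y < G (k + s + 1)} ∩ ball z ρ)) ^ (1 / (N : ℝ)) with ht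
  have htt : ∀ k, t k ≠ ∞ := by
    intro k
    refine ENNReal.rpow_ne_top_of_nonneg (by positivity) (ENNReal.mul_ne_top ?_ ?_)
    · exact ENNReal.div_ne_top (by finiteness) hω0
    · exact ((measure_mono inter_subset_right).trans_lt measure_ball_lt_top).ne
  by_contra hcon
  rw [not_le] at hcon
  -- room for enlarging each radius by a positive amount
  obtain ⟨ε, hε0, hε⟩ := ENNReal.exists_pos_sum_of_countable
    (ε := ENNReal.ofReal ρ - ∑' k, t k) (tsub_pos_of_lt hcon).ne' ℕ
  have hsum : ∑' k, (t k + ε k) < ENNReal.ofReal ρ := by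
    rw [ENNReal.tsum_add]
    calc _ < ∑' k, t k + (ENNReal.ofReal ρ - ∑' k, t k) :=
          ENNReal.add_lt_add_left (hcon.trans_le le_top).ne hε
      _ = _ := add_tsub_cancel_of_le hcon.le
  set R : ℕ → ℝ := fun k => (t k + ε k).toReal with hR
  have hRpos : ∀ k, 0 < R k := fun k => ENNReal.toReal_pos
    (by have := (hε0 k).ne'; simp [this]) (by simp [htt k])
  have hRE : ∀ k, ENNReal.ofReal (R k) = t k + ε k := fun k =>
    ENNReal.ofReal_toReal (by simp [htt k])
  set ρ' : ℝ := (∑' k, (t k + ε k)).toReal with hρ'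
  have hρ'ρ : ρ' < ρ := by
    rw [hρ']; exact (ENNReal.lt_ofReal_iff_toReal_lt hsum.ne_top).1 hsum
  have hpart : ∀ k, ∑ i ∈ Finset.range k, R i ≤ ρ' := by
    intro k
    rw [hρ', hR, ← ENNReal.toReal_sum (fun i _ => by simp [htt i])]
    exact ENNReal.toReal_mono hsum.ne_top (ENNReal.sum_le_tsum _)
  have hchain : ∀ k, ∃ x, dist x z ≤ ∑ i ∈ Finset.range k, R i ∧ G (k + s) ≤ v x := by
    intro k
    induction k with
    | zero => exact ⟨z, by simp, by simpa using hz⟩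
    | succ k ih =>
      obtain ⟨x, hxz, hvx⟩ := ih
      have hsub : closedBall x (R k) ⊆ ball z ρ := by
        refine (closedBall_subset_closedBall' (ε₂ := ρ') ?_).trans (closedBall_subset_ball hρ'ρ)
        have := hpart (k + 1)
        rw [Finset.sum_range_succ] at this
        linarith
      by_contra! hno
      have hlt : ∀ y ∈ ball x (R k), v y < G (k + s + 1) := by
        intro y hy
        have := hno y ?_
        · rwa [show k + 1 + s = k + s + 1 by ring] at this
        · rw [Finset.sum_range_succ]
          have h1 := dist_triangle y x z
          have h2 := (mem_ball.1 hy).le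
          linarith
      have hle := measure_le_of_le_mean measurableSet_ball
        (measure_ball_pos volume x (hRpos k)).ne' measure_ball_lt_top.ne
        (hmean x _ (hRpos k) hsub) hvx (hG2 k) (hGC (k + s)) (hG0.trans_le (hGm (Nat.zero_le _)))
        hlt
      have hle2 : ENNReal.ofReal (R k) ^ (N : ℝ) ≤ t k ^ (N : ℝ) := by
        rw [ht, ← ENNReal.rpow_mul, one_div, inv_mul_cancel₀ hN0, ENNReal.rpow_one,
          ← ENNReal.mul_div_right_comm, ENNReal.le_div_iff_mul_le (Or.inl hω0) (Or.inl hωt),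
          ← hvol x _ (hRpos k)]
        refine hle.trans ?_
        gcongr
        exact ball_subset_closedBall.trans hsub
      have hle3 := (ENNReal.rpow_le_rpow_iff (by positivity)).1 hle2
      rw [hRE] at hle3
      have : t k < t k + ε k := ENNReal.lt_add_right (htt k) (by simpa using (hε0 k).ne')
      exact absurd hle3 (not_le.2 this)
  -- the mean value inequality on balls of a fixed radius bounds `v` along the chain
  set η := (ρ - ρ') / 2 with hη
  have hη0 : 0 < η := by rw [hη]; linarith
  set b : ℝ≥0∞ := K / volume (ball z η) * ∫⁻ y in ball z ρ, v y with hb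
  have hbt : b ≠ ∞ := ENNReal.mul_ne_top
    (ENNReal.div_ne_top ENNReal.coe_ne_top (measure_ball_pos _ _ hη0).ne') hfin
  have hbd : ∀ x, dist x z ≤ ρ' → v x ≤ b := by
    intro x hx
    have hsub : closedBall x η ⊆ ball z ρ := by
      refine (closedBall_subset_closedBall' (ε₂ := η + ρ') ?_).trans (closedBall_subset_ball ?_)
      · linarith
      · rw [hη]; linarith
    refine (hmean x η hη0 hsub).trans ?_
    rw [hb, hvol x η hη0, hvol z η hη0]
    gcongr
    exact ball_subset_closedBall.trans hsub
  obtain ⟨i, hi⟩ := pow_unbounded_of_one_lt (b.toNNReal / G 0) (one_lt_two : (1 : ℝ≥0) < 2)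
  obtain ⟨x, hx, hvx⟩ := hchain (i * s)
  have h1 : (G (i * s + s) : ℝ≥0∞) ≤ b.toNNReal := by
    rw [ENNReal.coe_toNNReal hbt]; exact hvx.trans (hbd x (hx.trans (hpart _)))
  have h2 : G (i * s + s) ≤ b.toNNReal := by exact_mod_cast h1
  have h3 := two_pow_mul_le_of_two_mul_le hK hG2 i
  rw [div_lt_iff₀ hG0] at hi
  exact absurd (hi.trans_le (h3.trans (hGm (Nat.le_add_right _ _)))) (not_lt.2 h2)

/-- Each value `t` lies in at most `s + 1` of the windows `[G k, G (k + s + 1))`. -/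
theorem tsum_indicator_levels_le {G : ℕ → ℝ≥0} (hG : Monotone G) (s : ℕ) (t c : ℝ≥0∞) :
    ∑' k, {k | G k ≤ t ∧ t < G (k + s + 1)}.indicator (fun _ => c) k ≤ (s + 1) * c := by
  set T : Set ℕ := {k | G k ≤ t ∧ t < G (k + s + 1)}
  rcases T.eq_empty_or_nonempty with hT | hT
  · simp [hT]
  set k₀ := sInf T
  have hk₀ : k₀ ∈ T := Nat.sInf_mem hT
  have hsub : ∀ k ∈ T, k ∈ Finset.Icc k₀ (k₀ + s) := by
    intro k hk
    refine Finset.mem_Icc.2 ⟨Nat.sInf_le hk, ?_⟩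
    by_contra! h
    have h1 : (G (k₀ + s + 1) : ℝ≥0∞) ≤ G k := by exact_mod_cast hG h
    exact absurd (hk₀.2.trans_le (h1.trans hk.1)) (lt_irrefl _)
  rw [tsum_eq_sum (s := Finset.Icc k₀ (k₀ + s))
    fun k hk => indicator_of_notMem (fun h => hk (hsub k h)) _]
  refine (Finset.sum_le_card_nsmul _ _ c fun k _ => indicator_le_self' (by simp) k).trans ?_
  simp [show k₀ + s + 1 - k₀ = s + 1 by omega]

theorem ENNReal.tsum_mul_le_Lp_mul_Lq {p q : ℝ} (hpq : p.HolderConjugate q) (f g : ℕ → ℝ≥0∞) :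
    ∑' i, f i * g i ≤ (∑' i, f i ^ p) ^ (1 / p) * (∑' i, g i ^ q) ^ (1 / q) := by
  simpa [lintegral_count] using
    ENNReal.lintegral_mul_le_Lp_mul_Lq Measure.count hpq (f := f) (g := g)
      (measurable_of_countable _).aemeasurable (measurable_of_countable _).aemeasurable

/-- The constant in Domar's estimate `radius_rpow_le_of_le`: `2 K C / ν_N` comes from the chain of
balls, and `s + 1` bounds the overlap of the level sets. -/
noncomputable def domarConst (N s : ℕ) (K C : ℝ≥0) : ℝ≥0∞ :=
  2 * K * C / volume (ball (0 : EuclideanSpace ℝ (Fin N)) 1) * (s + 1)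

theorem domarConst_ne_top (N s : ℕ) (K C : ℝ≥0) : domarConst N s K C ≠ ∞ :=
  ENNReal.mul_ne_top (ENNReal.div_ne_top (by finiteness) (measure_ball_pos _ _ one_pos).ne')
    (by finiteness)

/-- Domar's estimate: Hölder's inequality with exponents `N / (N - 1)` and `N`, applied to the sum
of radii in `radius_le_tsum_of_le`. The hypothesis on `J` is the lower bound
`J ≥ a k ^ -(N - 1)` on `{v ≥ G k}`, written without inverses so that the values `0` and `∞` need no
separate treatment. -/
theorem radius_rpow_le_of_le {N : ℕ} (hN : 2 ≤ N) {v : EuclideanSpace ℝ (Fin N) → ℝ≥0∞}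
    {z : EuclideanSpace ℝ (Fin N)} {ρ : ℝ} {K C : ℝ≥0} (hK : 1 ≤ K)
    (hvm : AEMeasurable v (volume.restrict (ball z ρ)))
    (hmean : ∀ x r, 0 < r → closedBall x r ⊆ ball z ρ →
      v x ≤ K / volume (ball x r) * ∫⁻ y in ball x r, v y)
    (hfin : ∫⁻ y in ball z ρ, v y ≠ ∞) {s : ℕ} {G : ℕ → ℝ≥0} (hG0 : 0 < G 0) (hGm : Monotone G)
    (hG2 : ∀ k, 2 * K * G k ≤ G (k + s)) (hGC : ∀ k, G (k + 1) ≤ C * G k) (hz : G s ≤ v z)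
    {J : EuclideanSpace ℝ (Fin N) → ℝ≥0∞} (hJm : AEMeasurable J (volume.restrict (ball z ρ)))
    {a : ℕ → ℝ≥0∞}
    (hJ : ∀ k, ∀ x ∈ ball z ρ, G k ≤ v x → 1 ≤ a k ^ ((N : ℝ) - 1) * J x) :
    ENNReal.ofReal ρ ^ (N : ℝ) ≤
      domarConst N s K C * (∑' k, a k) ^ ((N : ℝ) - 1) * ∫⁻ x in ball z ρ, J x := by
  have hN2 : (2 : ℝ) ≤ N := by exact_mod_cast hN
  have hN0 : (0 : ℝ) < N := by linarith
  have hN1 : (0 : ℝ) < N - 1 := by linarith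
  set c := 2 * K * C / volume (ball (0 : EuclideanSpace ℝ (Fin N)) 1) with hc
  set μ := volume.restrict (ball z ρ) with hμ
  set A : ℕ → Set (EuclideanSpace ℝ (Fin N)) := fun k => {y | G k ≤ v y ∧ v y < G (k + s + 1)}
    with hA
  have hAm : ∀ k, NullMeasurableSet (A k) μ := fun k =>
    (nullMeasurableSet_le aemeasurable_const hvm).inter
      (nullMeasurableSet_lt hvm aemeasurable_const)
  set I : ℕ → ℝ≥0∞ := fun k => ∫⁻ x in A k, J x ∂μ with hI
  have hmk : ∀ k, volume (A k ∩ ball z ρ) ≤ a k ^ ((N : ℝ) - 1) * I k := by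
    intro k
    rw [← Measure.restrict_apply' measurableSet_ball, ← hμ, hI]
    simp only
    rw [← lintegral_const_mul'' _ (hJm.mono_measure Measure.restrict_le_self),
      ← setLIntegral_one]
    refine lintegral_mono_ae ?_
    have h1 : ∀ᵐ x ∂μ, x ∈ ball z ρ := ae_restrict_mem measurableSet_ball
    filter_upwards [ae_restrict_mem₀ (hAm k), ae_restrict_of_ae h1] with x hx hxb
    exact hJ k x hxb hx.1
  have hIsum : ∑' k, I k ≤ (s + 1) * ∫⁻ x in ball z ρ, J x := by
    calc ∑' k, I k = ∑' k, ∫⁻ x, (A k).indicator J x ∂μ := by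
          simp only [hI]
          exact tsum_congr fun k => (lintegral_indicator₀ (hAm k) _).symm
      _ = ∫⁻ x, ∑' k, (A k).indicator J x ∂μ :=
          (lintegral_tsum fun k => hJm.indicator₀ (hAm k)).symm
      _ ≤ ∫⁻ x, (s + 1) * J x ∂μ := by
          refine lintegral_mono fun x => ?_
          refine le_trans (le_of_eq ?_) (tsum_indicator_levels_le hGm s (v x) (J x))
          exact tsum_congr fun k => by simp [indicator, hA]
      _ = _ := lintegral_const_mul'' _ hJm
  have hpq : ((N : ℝ) / (N - 1)).HolderConjugate N := by
    rw [Real.holderConjugate_comm, Real.holderConjugate_iff]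
    refine ⟨by linarith, ?_⟩
    field_simp
    ring
  have h1 : ENNReal.ofReal ρ ≤ c ^ (1 / (N : ℝ)) *
      ((∑' k, a k) ^ (((N : ℝ) - 1) / N) * ((s + 1) * ∫⁻ x in ball z ρ, J x) ^ (1 / (N : ℝ))) := by
    calc ENNReal.ofReal ρ ≤ ∑' k, (c * volume (A k ∩ ball z ρ)) ^ (1 / (N : ℝ)) :=
          radius_le_tsum_of_le (by omega) hK hmean hfin hG0 hGm hG2 hGC hz
      _ ≤ ∑' k, c ^ (1 / (N : ℝ)) * (a k ^ (((N : ℝ) - 1) / N) * I k ^ (1 / (N : ℝ))) := by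
          refine ENNReal.tsum_le_tsum fun k => ?_
          rw [ENNReal.mul_rpow_of_nonneg _ _ (by positivity)]
          gcongr
          refine (ENNReal.rpow_le_rpow (hmk k) (by positivity)).trans (le_of_eq ?_)
          rw [ENNReal.mul_rpow_of_nonneg _ _ (by positivity), ← ENNReal.rpow_mul, mul_one_div]
      _ = c ^ (1 / (N : ℝ)) * ∑' k, (a k ^ (((N : ℝ) - 1) / N) * I k ^ (1 / (N : ℝ))) :=
          ENNReal.tsum_mul_left
      _ ≤ _ := by
          gcongr
          refine (ENNReal.tsum_mul_le_Lp_mul_Lq hpq _ _).trans ?_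
          simp only [← ENNReal.rpow_mul]
          rw [show ((N : ℝ) - 1) / N * (N / (N - 1)) = 1 by field_simp,
            show 1 / (N : ℝ) * N = 1 by field_simp, one_div_div]
          simp only [ENNReal.rpow_one]
          gcongr
  calc ENNReal.ofReal ρ ^ (N : ℝ) ≤ _ := ENNReal.rpow_le_rpow h1 hN0.le
    _ = domarConst N s K C * (∑' k, a k) ^ ((N : ℝ) - 1) * ∫⁻ x in ball z ρ, J x := by
        rw [ENNReal.mul_rpow_of_nonneg _ _ hN0.le, ENNReal.mul_rpow_of_nonneg _ _ hN0.le,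
          ← ENNReal.rpow_mul, ← ENNReal.rpow_mul, ← ENNReal.rpow_mul,
          show 1 / (N : ℝ) * N = 1 by field_simp,
          show ((N : ℝ) - 1) / N * N = N - 1 by field_simp, ENNReal.rpow_one, ENNReal.rpow_one,
          domarConst, ← hc]
        ring

/-! ### A Hardy type inequality for antitone sequences -/

theorem sum_rpow_sub_one_le {θ : ℝ} (hθ : 0 < θ) (hθ1 : θ ≤ 1) (l : ℕ) :
    ∑ i ∈ Finset.range l, ((i : ℝ) + 1) ^ (θ - 1) ≤ θ⁻¹ * (l : ℝ) ^ θ := by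
  induction l with
  | zero => simp [Real.zero_rpow hθ.ne']
  | succ l ih =>
    rw [Finset.sum_range_succ]
    refine (add_le_add_left ih _).trans ?_
    have hl : (0 : ℝ) < (l : ℝ) + 1 := by positivity
    have h1 : ((l : ℝ) / (l + 1)) ^ θ ≤ 1 - θ / (l + 1) := by
      have := rpow_one_add_le_one_add_mul_self (s := -(1 / ((l : ℝ) + 1))) (p := θ)
        (by rw [neg_le_neg_iff, div_le_one hl]; linarith [(Nat.cast_nonneg l : (0 : ℝ) ≤ l)])
        hθ.le hθ1
      convert this using 1
      · congr 1; field_simp; ring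
      · ring
    rw [Real.div_rpow (by positivity) hl.le, div_le_iff₀ (by positivity)] at h1
    have h2 : ((l : ℝ) + 1) ^ θ = (l + 1) ^ (θ - 1) * (l + 1) := by
      rw [← Real.rpow_add_one hl.ne', sub_add_cancel]
    have h3 : (1 - θ / ((l : ℝ) + 1)) * (l + 1) ^ θ = (l + 1) ^ θ - θ * (l + 1) ^ (θ - 1) := by
      rw [h2]; field_simp
    rw [h3] at h1
    push_cast
    calc θ⁻¹ * (l : ℝ) ^ θ + ((l : ℝ) + 1) ^ (θ - 1)
        = θ⁻¹ * ((l : ℝ) ^ θ + θ * ((l : ℝ) + 1) ^ (θ - 1)) := by field_simp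
      _ ≤ _ := by gcongr; linarith

/-- With `S` and `T = S - a p` consecutive partial sums, `S ^ θ - T ^ θ ≤ a p * S ^ (θ - 1)` as
`θ ≤ 1`, and `S ≥ (p + 1) a p` by antitonicity. -/
theorem sum_rpow_le_sum_of_antitone {θ : ℝ} (hθ : 0 < θ) (hθ1 : θ ≤ 1) {a : ℕ → ℝ}
    (ha : Antitone a) (ha0 : ∀ k, 0 < a k) (p : ℕ) :
    (∑ i ∈ Finset.range p, a i) ^ θ ≤
      ∑ i ∈ Finset.range p, ((i : ℝ) + 1) ^ (θ - 1) * a i ^ θ := by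
  induction p with
  | zero => simp [Real.zero_rpow hθ.ne']
  | succ p ih =>
    rw [Finset.sum_range_succ, Finset.sum_range_succ]
    set T := ∑ i ∈ Finset.range p, a i with hT
    have hT0 : 0 ≤ T := Finset.sum_nonneg fun i _ => (ha0 i).le
    have hpa : ((p : ℝ) + 1) * a p ≤ T + a p := by
      have : p • a p ≤ T := by
        have := Finset.card_nsmul_le_sum (Finset.range p) a (a p)
          fun i hi => ha (Finset.mem_range.1 hi).le
        simpa using this
      rw [nsmul_eq_mul] at this
      linarith
    have hS0 : 0 < T + a p := by linarith [ha0 p]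
    have h1 : T * (T + a p) ^ (θ - 1) ≤ T ^ θ := by
      rcases hT0.eq_or_lt with h | h
      · rw [← h]; simp [Real.zero_rpow hθ.ne']
      · calc T * (T + a p) ^ (θ - 1) ≤ T * T ^ (θ - 1) := by
              gcongr ?_ * ?_
              exact Real.rpow_le_rpow_of_nonpos h (by linarith [ha0 p]) (by linarith)
          _ = T ^ θ := by rw [mul_comm, ← Real.rpow_add_one h.ne', sub_add_cancel]
    have h2 : a p * (T + a p) ^ (θ - 1) ≤ ((p : ℝ) + 1) ^ (θ - 1) * a p ^ θ := by
      calc a p * (T + a p) ^ (θ - 1) ≤ a p * (((p : ℝ) + 1) * a p) ^ (θ - 1) := by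
            have := ha0 p
            gcongr ?_ * ?_
            exact Real.rpow_le_rpow_of_nonpos (by positivity) hpa (by linarith)
        _ = ((p : ℝ) + 1) ^ (θ - 1) * (a p ^ (θ - 1) * a p) := by
            rw [Real.mul_rpow (by positivity) (ha0 p).le]; ring
        _ = _ := by rw [← Real.rpow_add_one (ha0 p).ne', sub_add_cancel]
    calc (T + a p) ^ θ = T * (T + a p) ^ (θ - 1) + a p * (T + a p) ^ (θ - 1) := by
          rw [← add_mul, mul_comm, ← Real.rpow_add_one hS0.ne', sub_add_cancel]
      _ ≤ _ := by linarith

theorem tsum_ofReal_rpow_le_of_antitone {θ : ℝ} (hθ : 0 < θ) (hθ1 : θ ≤ 1) {a : ℕ → ℝ}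
    (ha : Antitone a) (ha0 : ∀ k, 0 < a k) :
    (∑' i, ENNReal.ofReal (a i)) ^ θ ≤
      ∑' i : ℕ, ENNReal.ofReal (((i : ℝ) + 1) ^ (θ - 1) * a i ^ θ) := by
  rw [← ENNReal.le_rpow_inv_iff hθ]
  rw [ENNReal.tsum_eq_iSup_nat]
  refine iSup_le fun p => ?_
  rw [ENNReal.le_rpow_inv_iff hθ, ← ENNReal.ofReal_sum_of_nonneg fun i _ => (ha0 i).le,
    ENNReal.ofReal_rpow_of_nonneg (Finset.sum_nonneg fun i _ => (ha0 i).le) hθ.le]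
  refine (ENNReal.ofReal_le_ofReal (sum_rpow_le_sum_of_antitone hθ hθ1 ha ha0 p)).trans ?_
  rw [ENNReal.ofReal_sum_of_nonneg fun i _ => by have := ha0 i; positivity]
  exact ENNReal.sum_le_tsum _

/-- Sum `tsum_ofReal_rpow_le_of_antitone` over all tails, collect the terms with the same
index `l` of `a`, and use `∑_{i ≤ l} (i + 1)^{θ-1} ≤ θ⁻¹ (l + 1)^θ`. Plain subadditivity of `t ↦ t ^ θ` would produce the
weight `l + 1` instead of `(l + 1)^θ`. -/
theorem tsum_tail_rpow_le_of_antitone {θ : ℝ} (hθ : 0 < θ) (hθ1 : θ ≤ 1) {a : ℕ → ℝ}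
    (ha : Antitone a) (ha0 : ∀ k, 0 < a k) :
    ∑' k, (∑' i, ENNReal.ofReal (a (i + k))) ^ θ ≤
      ENNReal.ofReal θ⁻¹ * ∑' l : ℕ, ENNReal.ofReal (((l : ℝ) + 1) ^ θ * a l ^ θ) := by
  calc ∑' k, (∑' i, ENNReal.ofReal (a (i + k))) ^ θ
      ≤ ∑' k : ℕ, ∑' i : ℕ, ENNReal.ofReal (((i : ℝ) + 1) ^ (θ - 1) * a (i + k) ^ θ) :=
        ENNReal.tsum_le_tsum fun k => tsum_ofReal_rpow_le_of_antitone hθ hθ1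
          (fun i j h => ha (by omega)) fun i => ha0 _
    _ = ∑' p : ℕ × ℕ, ENNReal.ofReal (((p.2 : ℝ) + 1) ^ (θ - 1) * a (p.2 + p.1) ^ θ) :=
        (ENNReal.tsum_prod (f := fun k i : ℕ =>
          ENNReal.ofReal (((i : ℝ) + 1) ^ (θ - 1) * a (i + k) ^ θ))).symm
    _ = ∑' l : ℕ, ∑' p : Finset.HasAntidiagonal.antidiagonal l,
          ENNReal.ofReal (((p.1.2 : ℝ) + 1) ^ (θ - 1) * a (p.1.2 + p.1.1) ^ θ) := by
        rw [← (Finset.HasAntidiagonal.sigmaAntidiagonalEquivProd (A := ℕ)).tsum_eq,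
          ENNReal.tsum_sigma']
        rfl
    _ ≤ ∑' l : ℕ, ENNReal.ofReal θ⁻¹ * ENNReal.ofReal (((l : ℝ) + 1) ^ θ * a l ^ θ) := by
        refine ENNReal.tsum_le_tsum fun l => ?_
        rw [tsum_fintype, Finset.sum_coe_sort (Finset.HasAntidiagonal.antidiagonal l) fun p : ℕ × ℕ =>
          ENNReal.ofReal (((p.2 : ℝ) + 1) ^ (θ - 1) * a (p.2 + p.1) ^ θ)]
        have h0 : ∀ k, 0 ≤ a k ^ θ := fun k => Real.rpow_nonneg (ha0 k).le _
        rw [← ENNReal.ofReal_mul (by positivity), ← ENNReal.ofReal_sum_of_nonneg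
          fun p _ => mul_nonneg (by positivity) (h0 _)]
        refine ENNReal.ofReal_le_ofReal ?_
        have h1 : ∑ p ∈ Finset.HasAntidiagonal.antidiagonal l,
              ((p.2 : ℝ) + 1) ^ (θ - 1) * a (p.2 + p.1) ^ θ =
            ∑ p ∈ Finset.HasAntidiagonal.antidiagonal l, ((p.2 : ℝ) + 1) ^ (θ - 1) * a l ^ θ :=
          Finset.sum_congr rfl fun p hp => by
            rw [add_comm p.2, Finset.HasAntidiagonal.mem_antidiagonal.1 hp]
        rw [h1, ← Finset.Nat.sum_antidiagonal_swap, Finset.Nat.sum_antidiagonal_eq_sum_range_succ_mk]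
        simp only [Prod.swap]
        rw [← Finset.sum_mul, ← mul_assoc]
        have h2 := sum_rpow_sub_one_le hθ hθ1 (l + 1)
        push_cast at h2
        exact mul_le_mul_of_nonneg_right h2 (h0 l)
    _ = _ := ENNReal.tsum_mul_left

/-! ### Local boundedness from separate mean value inequalities -/

/-- Domar's estimate applied in `y` and then in `x`. In the second application `y` is kept fixed, so
only the function `x ↦ ∫ Ψ (v x y') dy'`, and no supremum over `y`, has to be measurable. -/
theorem exists_bound_of_separately_le_mean {m n : ℕ} (hn : 2 ≤ n) (hmn : n ≤ m)
    {v : EuclideanSpace ℝ (Fin m) → EuclideanSpace ℝ (Fin n) → ℝ≥0∞}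
    {x₀ : EuclideanSpace ℝ (Fin m)} {y₀ : EuclideanSpace ℝ (Fin n)} {r : ℝ} (hr : 0 < r)
    {K C : ℝ≥0} (hK : 1 ≤ K)
    (hvm : AEMeasurable (fun p : EuclideanSpace ℝ (Fin m) × EuclideanSpace ℝ (Fin n) => v p.1 p.2)
      ((volume.restrict (ball x₀ (2 * r))).prod (volume.restrict (ball y₀ (2 * r)))))
    (hvx : ∀ y ∈ ball y₀ (2 * r),
      AEMeasurable (fun x => v x y) (volume.restrict (ball x₀ (2 * r))))
    (hvy : ∀ x ∈ ball x₀ (2 * r), AEMeasurable (v x) (volume.restrict (ball y₀ (2 * r))))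
    (hfinx : ∀ y ∈ ball y₀ (2 * r), ∫⁻ x in ball x₀ (2 * r), v x y ≠ ∞)
    (hfiny : ∀ x ∈ ball x₀ (2 * r), ∫⁻ y in ball y₀ (2 * r), v x y ≠ ∞)
    (hmeanx : ∀ y ∈ ball y₀ (2 * r), ∀ x t, 0 < t → closedBall x t ⊆ ball x₀ (2 * r) →
      v x y ≤ K / volume (ball x t) * ∫⁻ x' in ball x t, v x' y)
    (hmeany : ∀ x ∈ ball x₀ (2 * r), ∀ y t, 0 < t → closedBall y t ⊆ ball y₀ (2 * r) →
      v x y ≤ K / volume (ball y t) * ∫⁻ y' in ball y t, v x y')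
    {s : ℕ} {G : ℕ → ℝ≥0} (hG0 : 0 < G 0) (hGm : Monotone G)
    (hG2 : ∀ k, 2 * K * G k ≤ G (k + s)) (hGC : ∀ k, G (k + 1) ≤ C * G k)
    {a : ℕ → ℝ} (ha : Antitone a) (ha0 : ∀ k, 0 < a k)
    (hsum : ∑' l : ℕ, ENNReal.ofReal (((l : ℝ) + 1) ^ (((n : ℝ) - 1) / ((m : ℝ) - 1)) *
      a l ^ (((n : ℝ) - 1) / ((m : ℝ) - 1))) ≠ ∞)
    {Ψ : ℝ≥0∞ → ℝ≥0∞} (hΨm : Measurable Ψ)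
    (hΨ : ∀ (k : ℕ) (t : ℝ≥0∞), G k ≤ t → 1 ≤ ENNReal.ofReal (a k) ^ ((n : ℝ) - 1) * Ψ t)
    (hΨi : ∫⁻ x in ball x₀ (2 * r), ∫⁻ y in ball y₀ (2 * r), Ψ (v x y) ≠ ∞) :
    ∃ B : ℝ≥0, ∀ x ∈ ball x₀ r, ∀ y ∈ ball y₀ r, v x y ≤ B := by
  have hn2 : (2 : ℝ) ≤ n := by exact_mod_cast hn
  have hmn' : (n : ℝ) ≤ m := by exact_mod_cast hmn
  have hn1 : (0 : ℝ) < n - 1 := by linarith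
  have hm1 : (0 : ℝ) < m - 1 := by linarith
  set θ := ((n : ℝ) - 1) / ((m : ℝ) - 1) with hθ
  have hθ0 : 0 < θ := div_pos hn1 hm1
  have hθ1 : θ ≤ 1 := (div_le_one hm1).2 (by linarith)
  have hrE : ENNReal.ofReal r ≠ 0 := by simpa using hr
  set J : EuclideanSpace ℝ (Fin m) → ℝ≥0∞ := fun x => ∫⁻ y in ball y₀ (2 * r), Ψ (v x y) with hJ
  have hJm : AEMeasurable J (volume.restrict (ball x₀ (2 * r))) :=
    (hΨm.comp_aemeasurable hvm).lintegral_prod_right'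
  set D := domarConst n s K C / ENNReal.ofReal r ^ (n : ℝ) with hD
  have hDt : D ≠ ∞ := ENNReal.div_ne_top (domarConst_ne_top _ _ _ _)
    (ENNReal.rpow_pos (pos_iff_ne_zero.2 hrE) ENNReal.ofReal_ne_top).ne'
  set b : ℕ → ℝ≥0∞ :=
    fun k => D ^ (1 / ((m : ℝ) - 1)) * (∑' i, ENNReal.ofReal (a (i + k))) ^ θ with hb
  have hbsum : ∑' k, b k ≠ ∞ := by
    rw [hb, ENNReal.tsum_mul_left]
    refine ENNReal.mul_ne_top (ENNReal.rpow_ne_top_of_nonneg (by positivity) hDt) ?_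
    exact ne_top_of_le_ne_top (ENNReal.mul_ne_top ENNReal.ofReal_ne_top hsum)
      (tsum_tail_rpow_le_of_antitone hθ0 hθ1 ha ha0)
  have hsubx : ∀ x ∈ ball x₀ r, ball x r ⊆ ball x₀ (2 * r) := fun x hx =>
    ball_subset_ball' (by linarith [mem_ball.1 hx])
  have hsuby : ∀ y ∈ ball y₀ r, ball y r ⊆ ball y₀ (2 * r) := fun y hy =>
    ball_subset_ball' (by linarith [mem_ball.1 hy])
  have hG0' : ∀ k, 0 < G k := fun k => hG0.trans_le (hGm (Nat.zero_le k))
  have hystep : ∀ k, ∀ x ∈ ball x₀ (2 * r), ∀ y ∈ ball y₀ r, G (k + s) ≤ v x y →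
      1 ≤ b k ^ ((m : ℝ) - 1) * J x := by
    intro k x hx y hy hxy
    have h := radius_rpow_le_of_le (ρ := r) (G := fun i => G (i + k))
      (J := fun y => Ψ (v x y)) (a := fun i => ENNReal.ofReal (a (i + k))) hn hK
      ((hvy x hx).mono_set (hsuby y hy))
      (fun y' t ht hs => hmeany x hx y' t ht (hs.trans (hsuby y hy)))
      (ne_top_of_le_ne_top (hfiny x hx) (lintegral_mono_set (hsuby y hy)))
      (hG0' _) (fun i j h => hGm (by omega)) (fun i => by
        rw [add_right_comm]; exact hG2 _) (fun i => by rw [add_right_comm]; exact hGC _)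
      (by simpa only [add_comm] using hxy)
      (hΨm.comp_aemeasurable ((hvy x hx).mono_set (hsuby y hy)))
      (fun i y' _ h => hΨ _ _ h)
    have h2 : ENNReal.ofReal r ^ (n : ℝ) ≤ domarConst n s K C *
        (∑' i, ENNReal.ofReal (a (i + k))) ^ ((n : ℝ) - 1) * J x :=
      h.trans (by gcongr; exact lintegral_mono_set (hsuby y hy))
    have h3 : b k ^ ((m : ℝ) - 1) = D * (∑' i, ENNReal.ofReal (a (i + k))) ^ ((n : ℝ) - 1) := by
      rw [hb, ENNReal.mul_rpow_of_nonneg _ _ hm1.le, ← ENNReal.rpow_mul, ← ENNReal.rpow_mul,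
        one_div, inv_mul_cancel₀ hm1.ne', ENNReal.rpow_one, hθ, div_mul_cancel₀ _ hm1.ne']
    rw [h3, hD, ← ENNReal.mul_div_right_comm, ← ENNReal.mul_div_right_comm]
    rw [ENNReal.le_div_iff_mul_le (Or.inl
      (ENNReal.rpow_pos (pos_iff_ne_zero.2 hrE) ENNReal.ofReal_ne_top).ne')
      (Or.inl (by finiteness)), one_mul]
    exact h2
  have hlim : Tendsto (fun j => domarConst m s K C * (∑' k, b (k + j)) ^ ((m : ℝ) - 1) *
      ∫⁻ x in ball x₀ (2 * r), J x) atTop (𝓝 0) := by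
    have h1 := (ENNReal.tendsto_sum_nat_add b hbsum).ennrpow_const ((m : ℝ) - 1)
    rw [ENNReal.zero_rpow_of_pos hm1] at h1
    have h2 := ENNReal.Tendsto.const_mul h1 (Or.inr (domarConst_ne_top m s K C))
    have h3 := ENNReal.Tendsto.mul_const h2 (Or.inr hΨi)
    simpa using h3
  -- starting the levels at a large `j` contradicts the estimate for the radius `r`
  obtain ⟨j, hj⟩ := (hlim.eventually (gt_mem_nhds
    (ENNReal.rpow_pos (p := (m : ℝ)) (pos_iff_ne_zero.2 hrE) ENNReal.ofReal_ne_top))).exists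
  refine ⟨G (j + s + s), fun x hx y hy => ?_⟩
  by_contra! hlt
  have hyy : y ∈ ball y₀ (2 * r) := ball_subset_ball (by linarith) hy
  have h := radius_rpow_le_of_le (ρ := r) (G := fun i => G (i + (j + s)))
    (v := fun x => v x y) (J := J) (a := fun i => b (i + j)) (hn.trans hmn) hK
    ((hvx y hyy).mono_set (hsubx x hx))
    (fun x' t ht hs => hmeanx y hyy x' t ht (hs.trans (hsubx x hx)))
    (ne_top_of_le_ne_top (hfinx y hyy) (lintegral_mono_set (hsubx x hx)))
    (hG0' _) (fun i j h => hGm (by omega)) (fun i => by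
      rw [add_right_comm]; exact hG2 _) (fun i => by rw [add_right_comm]; exact hGC _)
    (by rw [add_comm s]; exact hlt.le)
    (hJm.mono_set (hsubx x hx))
    (fun i x' hx' h => hystep _ _ (hsubx x hx hx') _ hy (by rwa [add_assoc]))
  refine absurd (h.trans ?_) (not_le.2 hj)
  gcongr
  exact hsubx x hx

/-! ### The product structure of `ℝ^{m+n}` -/

/-- The isometry of the Euclidean product `ℝ^m × ℝ^n` with `ℝ^{m+n}` underlying `joinPt`. -/
noncomputable def joinIsometry (m n : ℕ) :
    WithLp 2 (EuclideanSpace ℝ (Fin m) × EuclideanSpace ℝ (Fin n)) ≃ₗᵢ[ℝ]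
      EuclideanSpace ℝ (Fin (m + n)) :=
  (PiLp.sumPiLpEquivProdLpPiLp (𝕜 := ℝ) 2 (fun _ : Fin m ⊕ Fin n => ℝ)).symm.trans
    (LinearIsometryEquiv.piLpCongrLeft 2 ℝ ℝ finSumFinEquiv)

theorem joinPt_eq_joinIsometry {m n : ℕ} (x : EuclideanSpace ℝ (Fin m))
    (y : EuclideanSpace ℝ (Fin n)) : joinPt x y = joinIsometry m n (WithLp.toLp 2 (x, y)) := by
  ext i
  refine Fin.addCases (fun i => ?_) (fun i => ?_) i <;>
    simp [joinPt, joinIsometry, LinearIsometryEquiv.piLpCongrLeft_apply, Equiv.piCongrLeft'_apply]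

theorem dist_joinPt {m n : ℕ} (x x' : EuclideanSpace ℝ (Fin m)) (y y' : EuclideanSpace ℝ (Fin n)) :
    dist (joinPt x y) (joinPt x' y') = √(dist x x' ^ 2 + dist y y' ^ 2) := by
  simp only [joinPt_eq_joinIsometry, LinearIsometryEquiv.dist_map, WithLp.prod_dist_eq_of_L2]
  rfl

theorem exists_joinPt_eq {m n : ℕ} (z : EuclideanSpace ℝ (Fin (m + n))) :
    ∃ (x : EuclideanSpace ℝ (Fin m)) (y : EuclideanSpace ℝ (Fin n)), joinPt x y = z := by
  refine ⟨WithLp.toLp 2 fun i => z (Fin.castAdd n i), WithLp.toLp 2 fun j => z (Fin.natAdd m j), ?_⟩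
  ext i
  refine Fin.addCases (fun i => ?_) (fun i => ?_) i <;> simp [joinPt]

theorem measurePreserving_joinPt (m n : ℕ) :
    MeasurePreserving (fun p : EuclideanSpace ℝ (Fin m) × EuclideanSpace ℝ (Fin n) =>
      joinPt p.1 p.2) := by
  simp only [joinPt_eq_joinIsometry]
  exact (joinIsometry m n).measurePreserving.comp (WithLp.volume_preserving_toLp _ _)

theorem measurableEmbedding_joinPt (m n : ℕ) :
    MeasurableEmbedding (fun p : EuclideanSpace ℝ (Fin m) × EuclideanSpace ℝ (Fin n) =>
      joinPt p.1 p.2) := by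
  simp only [joinPt_eq_joinIsometry]
  exact (joinIsometry m n).toMeasurableEquiv.measurableEmbedding.comp
    (MeasurableEquiv.toLp 2 _).measurableEmbedding

theorem dist_joinPt_lt {m n : ℕ} {x x' : EuclideanSpace ℝ (Fin m)}
    {y y' : EuclideanSpace ℝ (Fin n)} {r : ℝ} (hr : 0 < r) (hx : dist x x' ≤ r)
    (hy : dist y y' ≤ r) : dist (joinPt x y) (joinPt x' y') < 2 * r := by
  rw [dist_joinPt, Real.sqrt_lt' (by positivity)]
  have h1 := pow_le_pow_left₀ dist_nonneg hx 2
  have h2 := pow_le_pow_left₀ dist_nonneg hy 2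
  nlinarith [pow_pos hr 2]

theorem image_joinPt_ball_prod_subset {m n : ℕ} (x : EuclideanSpace ℝ (Fin m))
    (y : EuclideanSpace ℝ (Fin n)) {r : ℝ} (hr : 0 < r) :
    (fun p : EuclideanSpace ℝ (Fin m) × EuclideanSpace ℝ (Fin n) => joinPt p.1 p.2) ''
      (ball x r ×ˢ ball y r) ⊆ ball (joinPt x y) (2 * r) := by
  rintro _ ⟨p, hp, rfl⟩
  exact dist_joinPt_lt hr (mem_ball.1 hp.1).le (mem_ball.1 hp.2).le

theorem aemeasurable_comp_joinPt {m n : ℕ} {β : Type*} [MeasurableSpace β]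
    {f : EuclideanSpace ℝ (Fin (m + n)) → β} {x : EuclideanSpace ℝ (Fin m)}
    {y : EuclideanSpace ℝ (Fin n)} {r : ℝ} (hr : 0 < r)
    (hf : AEMeasurable f (volume.restrict (ball (joinPt x y) (2 * r)))) :
    AEMeasurable (fun p : EuclideanSpace ℝ (Fin m) × EuclideanSpace ℝ (Fin n) =>
      f (joinPt p.1 p.2)) ((volume.restrict (ball x r)).prod (volume.restrict (ball y r))) := by
  rw [Measure.prod_restrict]
  exact (hf.mono_set (image_joinPt_ball_prod_subset x y hr)).comp_quasiMeasurePreserving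
    ((measurePreserving_joinPt m n).restrict_image_emb
      (measurableEmbedding_joinPt m n) _).quasiMeasurePreserving

theorem lintegral_joinPt_le {m n : ℕ} {f : EuclideanSpace ℝ (Fin (m + n)) → ℝ≥0∞}
    {x : EuclideanSpace ℝ (Fin m)} {y : EuclideanSpace ℝ (Fin n)} {r : ℝ} (hr : 0 < r)
    (hf : AEMeasurable f (volume.restrict (ball (joinPt x y) (2 * r)))) :
    ∫⁻ x' in ball x r, ∫⁻ y' in ball y r, f (joinPt x' y') ≤
      ∫⁻ z in ball (joinPt x y) (2 * r), f z := by
  have h := lintegral_prod _ (aemeasurable_comp_joinPt hr hf)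
  simp only at h
  rw [← h, Measure.prod_restrict]
  refine le_trans (le_of_eq ?_) (lintegral_mono_set (image_joinPt_ball_prod_subset x y hr))
  exact (measurePreserving_joinPt m n).setLIntegral_comp_emb (measurableEmbedding_joinPt m n) f _

theorem exists_volume_ball_eq_mul (m n : ℕ) : ∃ c : ℝ≥0∞, c ≠ 0 ∧ c ≠ ∞ ∧
    ∀ (x : EuclideanSpace ℝ (Fin m)) (y : EuclideanSpace ℝ (Fin n))
      (z : EuclideanSpace ℝ (Fin (m + n))) (r : ℝ), 0 < r →
      volume (ball z (2 * r)) = c * (volume (ball x r) * volume (ball y r)) := by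
  have hpos : ∀ N : ℕ, volume (ball (0 : EuclideanSpace ℝ (Fin N)) 1) ≠ 0 :=
    fun N => (measure_ball_pos _ _ one_pos).ne'
  have hfin : ∀ N : ℕ, volume (ball (0 : EuclideanSpace ℝ (Fin N)) 1) ≠ ∞ :=
    fun N => measure_ball_lt_top.ne
  refine ⟨ENNReal.ofReal (2 ^ (m + n)) *
    volume (ball (0 : EuclideanSpace ℝ (Fin (m + n))) 1) /
    (volume (ball (0 : EuclideanSpace ℝ (Fin m)) 1) *
      volume (ball (0 : EuclideanSpace ℝ (Fin n)) 1)), ?_, ?_, ?_⟩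
  · refine ENNReal.div_ne_zero.2 ⟨mul_ne_zero (by simp) (hpos _), ENNReal.mul_ne_top (hfin _) (hfin _)⟩
  · exact ENNReal.div_ne_top (ENNReal.mul_ne_top (by simp) (hfin _)) (mul_ne_zero (hpos _) (hpos _))
  · intro x y z r hr
    rw [Measure.addHaar_ball_of_pos _ _ hr, Measure.addHaar_ball_of_pos _ _ hr,
      Measure.addHaar_ball_of_pos _ _ (by positivity : 0 < 2 * r)]
    simp only [finrank_euclideanSpace_fin]
    set ωm := volume (ball (0 : EuclideanSpace ℝ (Fin m)) 1)
    set ωn := volume (ball (0 : EuclideanSpace ℝ (Fin n)) 1)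
    set ω := volume (ball (0 : EuclideanSpace ℝ (Fin (m + n))) 1)
    rw [mul_pow, ENNReal.ofReal_mul (by positivity), pow_add r, ENNReal.ofReal_mul (by positivity),
      div_eq_mul_inv]
    calc _ = ENNReal.ofReal (2 ^ (m + n)) * ω * ENNReal.ofReal (r ^ m) * ENNReal.ofReal (r ^ n) *
          1 := by ring
      _ = ENNReal.ofReal (2 ^ (m + n)) * ω * ENNReal.ofReal (r ^ m) * ENNReal.ofReal (r ^ n) *
          ((ωm * ωn)⁻¹ * (ωm * ωn)) := by
        rw [ENNReal.inv_mul_cancel (mul_ne_zero (hpos _) (hpos _))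
          (ENNReal.mul_ne_top (hfin _) (hfin _))]
      _ = _ := by ring

/-! ### Truncations and positive parts -/

theorem measurable_truncShift_one_variable (M : ℝ) :
    Measurable fun t : EReal => (max t ((-M : ℝ) : EReal) + (M : EReal)).toENNReal := by
  refine Monotone.measurable fun a b h => ?_
  exact EReal.toENNReal_le_toENNReal (add_le_add_left (max_le_max_right _ h) _)

theorem AEMeasurable.truncShift {α : Type*} [MeasurableSpace α] {μ : Measure α} {u : α → EReal}
    (hu : AEMeasurable u μ) (M : ℝ) : AEMeasurable (truncShift M u) μ :=
  (measurable_truncShift_one_variable M).comp_aemeasurable hu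

theorem truncShift_zero_eq_ofReal {α : Type*} {u : α → EReal} {x : α} (h : u x < ⊤) :
    truncShift 0 u x = ENNReal.ofReal (posPartReal u x) := by
  have h1 : max (u x) 0 ≠ ⊤ := by simp [h.ne]
  simp only [truncShift, posPartReal]
  rw [← EReal.toENNReal_of_ne_top h1]
  simp

theorem posPartReal_nonneg {α : Type*} (u : α → EReal) (x : α) : 0 ≤ posPartReal u x :=
  EReal.toReal_nonneg (le_max_right _ _)

theorem aemeasurable_posPartReal {α : Type*} [MeasurableSpace α] {μ : Measure α} {u : α → EReal}
    (hu : AEMeasurable u μ) : AEMeasurable (posPartReal u) μ :=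
  (measurable_ereal_toReal.comp (measurable_id.max measurable_const)).comp_aemeasurable hu

theorem IsQuasiNearlySubharmonicWith.lintegral_truncShift_ne_top {N : ℕ} {K : ℝ}
    {u : EuclideanSpace ℝ (Fin N) → EReal} {D : Set (EuclideanSpace ℝ (Fin N))}
    (hu : IsQuasiNearlySubharmonicWith K u D) {x : EuclideanSpace ℝ (Fin N)} {r : ℝ}
    (hD : closedBall x r ⊆ D) : ∫⁻ y in ball x r, truncShift 0 u y ≠ ∞ := by
  have h := (hu.locallyIntegrable.integrableOn_compact_subset hD (isCompact_closedBall x r)).mono_set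
    ball_subset_closedBall
  rw [setLIntegral_congr_fun (g := fun y => ENNReal.ofReal (posPartReal u y)) measurableSet_ball
    fun y hy => truncShift_zero_eq_ofReal (hu.lt_top y (hD (ball_subset_closedBall hy)))]
  exact (Integrable.lintegral_lt_top h).ne

/-! ### The theorem -/

/-- The mean value inequality on `ball z (2 * t)`, from the separate ones on the two balls of radius
`t` whose product lies inside it. -/
theorem exists_mean_le_of_separately {m n : ℕ} {Ω : Set (EuclideanSpace ℝ (Fin (m + n)))} {K : ℝ}
    {u : EuclideanSpace ℝ (Fin (m + n)) → EReal} (hu_meas : AEMeasurable u (volume.restrict Ω))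
    (ha : ∀ y : EuclideanSpace ℝ (Fin n),
      IsQuasiNearlySubharmonicWith K (fun x => u (joinPt x y)) (sectionAtSnd Ω y))
    (hb : ∀ x : EuclideanSpace ℝ (Fin m),
      IsQuasiNearlySubharmonicWith K (fun y => u (joinPt x y)) (sectionAtFst Ω x)) :
    ∃ K' : ℝ, 1 ≤ K' ∧ ∀ (z : EuclideanSpace ℝ (Fin (m + n))) (r : ℝ), 0 < r →
      closedBall z r ⊆ Ω → ∀ M : ℝ, 0 ≤ M → truncShift M u z ≤
        ENNReal.ofReal K' / volume (ball z r) * ∫⁻ w in ball z r, truncShift M u w := by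
  obtain ⟨c, hc0, hct, hc⟩ := exists_volume_ball_eq_mul m n
  refine ⟨max 1 (ENNReal.ofReal K * ENNReal.ofReal K * c).toReal, le_max_left _ _,
    fun z r hr hz M hM => ?_⟩
  obtain ⟨x, y, rfl⟩ := exists_joinPt_eq z
  obtain ⟨t, rfl⟩ : ∃ t, r = 2 * t := ⟨r / 2, by ring⟩
  have ht : 0 < t := by linarith
  have hKc : ENNReal.ofReal K * ENNReal.ofReal K * c ≤
      ENNReal.ofReal (max 1 (ENNReal.ofReal K * ENNReal.ofReal K * c).toReal) := by
    refine le_trans ?_ (ENNReal.ofReal_le_ofReal (le_max_right _ _))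
    rw [ENNReal.ofReal_toReal (by finiteness)]
  have hx : closedBall x t ⊆ sectionAtSnd Ω y := fun x' hx' =>
    hz (dist_joinPt_lt ht hx' (by simpa using ht.le)).le
  have hy : ∀ x' ∈ ball x t, closedBall y t ⊆ sectionAtFst Ω x' := fun x' hx' y' hy' =>
    hz (dist_joinPt_lt ht (mem_ball.1 hx').le hy').le
  have hm := (hu_meas.mono_set (ball_subset_closedBall.trans hz)).truncShift M
  have hBn0 : volume (ball y t) ≠ 0 := (measure_ball_pos _ _ ht).ne'
  have hBnt : volume (ball y t) ≠ ∞ := measure_ball_lt_top.ne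
  have hBm0 : volume (ball x t) ≠ 0 := (measure_ball_pos _ _ ht).ne'
  have hBmt : volume (ball x t) ≠ ∞ := measure_ball_lt_top.ne
  calc truncShift M u (joinPt x y)
      ≤ ENNReal.ofReal K / volume (ball x t) *
          ∫⁻ x' in ball x t, truncShift M u (joinPt x' y) := (ha y).le_mean x t ht hx M hM
    _ ≤ ENNReal.ofReal K / volume (ball x t) *
          ∫⁻ x' in ball x t, ENNReal.ofReal K / volume (ball y t) *
            ∫⁻ y' in ball y t, truncShift M u (joinPt x' y') := by
        refine mul_le_mul_right ?_ _
        exact setLIntegral_mono' measurableSet_ball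
          fun x' hx' => (hb x').le_mean y t ht (hy x' hx') M hM
    _ = ENNReal.ofReal K / volume (ball x t) * (ENNReal.ofReal K / volume (ball y t)) *
          ∫⁻ x' in ball x t, ∫⁻ y' in ball y t, truncShift M u (joinPt x' y') := by
        rw [lintegral_const_mul' _ _ (ENNReal.div_ne_top ENNReal.ofReal_ne_top hBn0), mul_assoc]
    _ ≤ _ := by
        refine mul_le_mul' ?_ (lintegral_joinPt_le ht hm)
        rw [hc x y _ t ht]
        refine le_trans (le_of_eq ?_) (ENNReal.div_le_div_right hKc _)
        rw [mul_comm _ c, ENNReal.mul_div_mul_left _ _ hc0 hct, div_eq_mul_inv, div_eq_mul_inv,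
          div_eq_mul_inv, ENNReal.mul_inv (Or.inl hBm0) (Or.inl hBmt)]
        ring

/-- The levels `G k = (ψ⁻¹ ∘ φ)(s₁ + 1 + k)` and weights `a k = φ(s₁ + 1 + k)^{-1/(n-1)}`. Starting
at `s₁ + 1` makes the hypothesis `hc3` available and keeps the arguments above `s₁ - s₀`, where
`φ` is strictly increasing, so that `G k` and `φ(s₁ + 1 + k)` are positive. -/
theorem exists_levels {m n : ℕ} (hn : 2 ≤ n) (hmn : n ≤ m) {K : ℝ} (hK : 1 ≤ K) {φ ψ : ℝ → ℝ}
    (hφ_maps : MapsTo φ (Ici 0) (Ici 0))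
    (hφ_mono : MonotoneOn φ (Ici 0)) (hψ_mono : MonotoneOn ψ (Ici 0))
    {s₀ s₁ : ℕ} (hs : s₀ < s₁)
    (hc1φ : InverseDefinedOn φ (Ici (min (φ ((s₁ : ℝ) - s₀)) (ψ ((s₁ : ℝ) - s₀)))))
    (hc1ψ : InverseDefinedOn ψ (Ici (min (φ ((s₁ : ℝ) - s₀)) (ψ ((s₁ : ℝ) - s₀)))))
    (hc2 : ∀ s : ℝ, (s₁ : ℝ) ≤ s → 2 * K * invComp ψ φ (s - s₀) ≤ invComp ψ φ s)
    (hc3 : ∃ C : ℝ, ∀ s : ℝ, (s₁ : ℝ) + 1 ≤ s → |invComp ψ φ (s + 1) / invComp ψ φ s| ≤ C)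
    (hc4 : IntegrableOn
      (fun s : ℝ => s ^ (((n : ℝ) - 1) / ((m : ℝ) - 1)) / (φ (s - s₀)) ^ (1 / ((m : ℝ) - 1)))
      (Ioi (s₁ : ℝ)) volume) :
    ∃ (G : ℕ → ℝ≥0) (C : ℝ≥0) (a : ℕ → ℝ), 0 < G 0 ∧ Monotone G ∧
      (∀ k, 2 * K.toNNReal * G k ≤ G (k + s₀)) ∧ (∀ k, G (k + 1) ≤ C * G k) ∧
      Antitone a ∧ (∀ k, 0 < a k) ∧
      ∑' l : ℕ, ENNReal.ofReal (((l : ℝ) + 1) ^ (((n : ℝ) - 1) / ((m : ℝ) - 1)) *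
        a l ^ (((n : ℝ) - 1) / ((m : ℝ) - 1))) ≠ ∞ ∧
      ∀ k (t : ℝ), G k ≤ t → 1 ≤ a k ^ ((n : ℝ) - 1) * ψ t := by
  have hn2 : (2 : ℝ) ≤ n := by exact_mod_cast hn
  have hmn' : (n : ℝ) ≤ m := by exact_mod_cast hmn
  have hn1 : (0 : ℝ) < n - 1 := by linarith
  have hm1 : (0 : ℝ) < m - 1 := by linarith
  have hs' : (s₀ : ℝ) < s₁ := by exact_mod_cast hs
  have hs₁ : (1 : ℝ) ≤ s₁ := by exact_mod_cast (Nat.succ_le_of_lt (Nat.zero_lt_of_lt hs))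
  have hs₀ : (0 : ℝ) ≤ s₀ := by positivity
  set σ : ℝ := (s₁ : ℝ) - s₀ with hσ
  have hσ0 : 0 < σ := by linarith
  set τ := min (φ σ) (ψ σ) with hτ
  have hφτ : ∀ s, σ ≤ s → φ s ∈ Ici τ := fun s h =>
    (min_le_left _ _).trans (hφ_mono hσ0.le (hσ0.le.trans h) h)
  have hφlt : ∀ s t, σ ≤ s → s < t → φ s < φ t := by
    intro s t h1 h2
    have h0 : 0 ≤ s := hσ0.le.trans h1
    refine (hφ_mono h0 (h0.trans h2.le) h2.le).lt_of_ne fun he => ?_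
    exact h2.ne ((hc1φ (φ s) (hφτ s h1)).unique ⟨h0, rfl⟩ ⟨h0.trans h2.le, he.symm⟩)
  have hφpos : ∀ s, σ < s → 0 < φ s := fun s h =>
    lt_of_le_of_lt (hφ_maps (mem_Ici.2 hσ0.le)) (hφlt σ s le_rfl h)
  set g := invComp ψ φ with hg
  have hex : ∀ s, σ ≤ s → ∃ t ∈ Ici (0 : ℝ), ψ t = φ s := fun s h =>
    (hc1ψ (φ s) (hφτ s h)).exists
  have hg0 : ∀ s, σ ≤ s → 0 ≤ g s := fun s h => Function.invFunOn_mem (hex s h)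
  have hψg : ∀ s, σ ≤ s → ψ (g s) = φ s := fun s h => Function.invFunOn_eq (hex s h)
  have hgm : ∀ s t, σ ≤ s → s ≤ t → g s ≤ g t := by
    intro s t h1 h2
    rcases h2.eq_or_lt with rfl | h2
    · exact le_rfl
    by_contra! hlt
    have h3 := hψ_mono (hg0 t (h1.trans h2.le)) (hg0 s h1) hlt.le
    rw [hψg s h1, hψg t (h1.trans h2.le)] at h3
    exact absurd (hφlt s t h1 h2) (not_lt.2 h3)
  have hgpos : ∀ s, σ < s → 0 < g s := by
    intro s h
    refine (hg0 s h.le).lt_of_ne fun he => ?_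
    have h1 := hψ_mono (mem_Ici.2 le_rfl) (hg0 σ le_rfl) (hg0 σ le_rfl)
    have h2 := hψg s h.le
    rw [hψg σ le_rfl] at h1
    rw [← he] at h2
    linarith [hφlt σ s le_rfl h]
  set p : ℕ → ℝ := fun k => (s₁ : ℝ) + 1 + k with hp
  have hpσ : ∀ k, σ < p k := fun k => by
    have : (0 : ℝ) ≤ k := by positivity
    simp only [hp, hσ]; linarith
  obtain ⟨C, hC⟩ := hc3
  refine ⟨fun k => (g (p k)).toNNReal, C.toNNReal, fun k => φ (p k) ^ (-(1 / ((n : ℝ) - 1))),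
    ?_, ?_, ?_, ?_, ?_, ?_, ?_, ?_⟩
  · simpa using hgpos _ (hpσ 0)
  · intro i j h
    refine Real.toNNReal_mono (hgm _ _ (hpσ i).le ?_)
    simp only [hp]; gcongr
  · intro k
    have h := hc2 (p k + s₀) (by
      have : (0 : ℝ) ≤ k := by positivity
      simp only [hp]; linarith)
    rw [add_sub_cancel_right] at h
    rw [← NNReal.coe_le_coe]
    push_cast
    rw [Real.coe_toNNReal _ (by linarith), Real.coe_toNNReal _ (hgpos _ (hpσ _)).le,
      Real.coe_toNNReal _ (hgpos _ (hpσ _)).le]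
    convert h using 2
    simp only [hp]; push_cast; ring
  · intro k
    have h := hC (p k) (by simp [hp])
    have h0 := hgpos _ (hpσ k)
    have h1 : p (k + 1) = p k + 1 := by simp only [hp]; push_cast; ring
    have h2 : g (p k + 1) ≤ C * g (p k) := by
      rw [← div_le_iff₀ h0]
      exact (le_abs_self _).trans h
    have hC0 : 0 ≤ C := (abs_nonneg _).trans h
    simp only [h1]
    rw [← Real.toNNReal_mul hC0]
    exact Real.toNNReal_mono h2
  · intro i j h
    refine Real.rpow_le_rpow_of_nonpos (hφpos _ (hpσ i)) ?_ ?_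
    · refine hφ_mono (hσ0.le.trans (hpσ i).le) (hσ0.le.trans (hpσ j).le) ?_
      simp only [hp]; gcongr
    · have : 0 < 1 / ((n : ℝ) - 1) := by positivity
      linarith
  · intro k
    exact Real.rpow_pos_of_pos (hφpos _ (hpσ k)) _
  · set θ := ((n : ℝ) - 1) / ((m : ℝ) - 1) with hθ
    have hθ0 : 0 < θ := by positivity
    set f : ℝ → ℝ := fun s => s ^ θ / (φ (s - s₀)) ^ (1 / ((m : ℝ) - 1)) with hf
    set T : ℕ → Set ℝ := fun l => Ioc (((s₁ : ℝ) + s₀) + (l : ℤ)) (((s₁ : ℝ) + s₀) + (l : ℤ) + 1)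
      with hT
    have hdisj : Pairwise (Function.onFun Disjoint T) := fun i j h =>
      pairwise_disjoint_Ioc_add_intCast ((s₁ : ℝ) + s₀) (by exact_mod_cast h : (i : ℤ) ≠ j)
    have hTsub : (⋃ l, T l) ⊆ Ioi (s₁ : ℝ) := by
      refine iUnion_subset fun l s hs => ?_
      have := hs.1
      have h2 : (0 : ℝ) ≤ l := by positivity
      push_cast at this
      exact mem_Ioi.2 (by linarith)
    refine ne_top_of_le_ne_top (Integrable.lintegral_lt_top hc4).ne ?_
    calc _ ≤ ∑' l, ∫⁻ s in T l, ENNReal.ofReal (f s) := ENNReal.tsum_le_tsum fun l => ?_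
      _ = ∫⁻ s in ⋃ l, T l, ENNReal.ofReal (f s) :=
          (lintegral_iUnion (fun l => measurableSet_Ioc) hdisj _).symm
      _ ≤ _ := lintegral_mono_set hTsub
    -- on `T l`, of length one, `s ≥ l + 1` and `s - s₀ ≤ s₁ + 1 + l`
    have hvol : volume (T l) = 1 := by simp [hT, Real.volume_Ioc]
    have hl0 : (0 : ℝ) ≤ l := by positivity
    rw [← mul_one (ENNReal.ofReal _), ← hvol, ← setLIntegral_const]
    refine setLIntegral_mono' measurableSet_Ioc fun s hs => ENNReal.ofReal_le_ofReal ?_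
    have hs1 : (s₁ : ℝ) + s₀ + l < s := by simpa [hT] using hs.1
    have hs2 : s ≤ (s₁ : ℝ) + s₀ + l + 1 := by simpa [hT] using hs.2
    have hσs : σ < s - s₀ := by simp only [hσ]; linarith
    have hle : φ (s - s₀) ≤ φ (p l) := hφ_mono (hσ0.le.trans hσs.le) (hσ0.le.trans (hpσ l).le) (by
      simp only [hp]; linarith)
    have hpos := hφpos _ hσs
    rw [← Real.rpow_mul (hφpos _ (hpσ l)).le,
      show -(1 / ((n : ℝ) - 1)) * θ = -(1 / ((m : ℝ) - 1)) by rw [hθ]; field_simp,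
      Real.rpow_neg (hφpos _ (hpσ l)).le, ← div_eq_mul_inv]
    have hs0 : 0 ≤ s := by linarith
    have hls : (l : ℝ) + 1 ≤ s := by linarith
    simp only [hf]
    gcongr
  · intro k t ht
    have h0 := hgpos _ (hpσ k)
    rw [Real.coe_toNNReal _ h0.le] at ht
    have h1 := hψ_mono h0.le (h0.le.trans ht) ht
    rw [hψg _ (hpσ k).le] at h1
    have h2 := hφpos _ (hpσ k)
    rw [← Real.rpow_mul h2.le, show -(1 / ((n : ℝ) - 1)) * ((n : ℝ) - 1) = -1 by field_simp,
      Real.rpow_neg_one, ← div_eq_inv_mul, one_le_div h2]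
    exact h1

/-- `u` is locally bounded from above, hence `u⁺` is locally integrable. -/
theorem locallyIntegrableOn_posPartReal_of_separately {m n : ℕ} (hn : 2 ≤ n) (hmn : n ≤ m)
    {Ω : Set (EuclideanSpace ℝ (Fin (m + n)))} (hΩ_open : IsOpen Ω)
    {K : ℝ} (hK : 1 ≤ K)
    {u : EuclideanSpace ℝ (Fin (m + n)) → EReal}
    (hu_top : ∀ z ∈ Ω, u z < ⊤)
    (hu_meas : AEMeasurable u (volume.restrict Ω))
    (ha : ∀ y : EuclideanSpace ℝ (Fin n),
      IsQuasiNearlySubharmonicWith K (fun x => u (joinPt x y)) (sectionAtSnd Ω y))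
    (hb : ∀ x : EuclideanSpace ℝ (Fin m),
      IsQuasiNearlySubharmonicWith K (fun y => u (joinPt x y)) (sectionAtFst Ω x))
    {φ ψ : ℝ → ℝ}
    (hφ_maps : MapsTo φ (Ici 0) (Ici 0))
    (hφ_mono : MonotoneOn φ (Ici 0)) (hψ_mono : MonotoneOn ψ (Ici 0))
    {s₀ s₁ : ℕ} (hs : s₀ < s₁)
    (hc1φ : InverseDefinedOn φ (Ici (min (φ ((s₁ : ℝ) - s₀)) (ψ ((s₁ : ℝ) - s₀)))))
    (hc1ψ : InverseDefinedOn ψ (Ici (min (φ ((s₁ : ℝ) - s₀)) (ψ ((s₁ : ℝ) - s₀)))))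
    (hc2 : ∀ s : ℝ, (s₁ : ℝ) ≤ s → 2 * K * invComp ψ φ (s - s₀) ≤ invComp ψ φ s)
    (hc3 : ∃ C : ℝ, ∀ s : ℝ, (s₁ : ℝ) + 1 ≤ s → |invComp ψ φ (s + 1) / invComp ψ φ s| ≤ C)
    (hc4 : IntegrableOn
      (fun s : ℝ => s ^ (((n : ℝ) - 1) / ((m : ℝ) - 1)) / (φ (s - s₀)) ^ (1 / ((m : ℝ) - 1)))
      (Ioi (s₁ : ℝ)) volume)
    (hc5 : LocallyIntegrableOn (fun z => ψ (posPartReal u z)) Ω volume) :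
    LocallyIntegrableOn (posPartReal u) Ω volume := by
  obtain ⟨G, C, a, hG0, hGm, hG2, hGC, haa, ha0, hsum, hψ⟩ :=
    exists_levels hn hmn hK hφ_maps hφ_mono hψ_mono hs hc1φ hc1ψ hc2 hc3 hc4
  have hK' : 1 ≤ K.toNNReal := by simpa using hK
  -- `ψ` on `[0, ∞]`; the value `∞` at `∞` keeps the lower bound `hΨ1` valid there
  set Ψ : ℝ≥0∞ → ℝ≥0∞ := fun t => if t = ∞ then ∞ else ENNReal.ofReal (ψ t.toReal) with hΨ
  have hΨm : Measurable Ψ := by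
    refine Measurable.ite (measurableSet_singleton _) measurable_const ?_
    have h1 : Measurable fun t : ℝ => ψ (max t 0) := Monotone.measurable fun s t h =>
      hψ_mono (mem_Ici.2 (le_max_right _ _)) (mem_Ici.2 (le_max_right _ _)) (max_le_max_right _ h)
    refine ENNReal.measurable_ofReal.comp ?_
    have h2 : (fun t : ℝ≥0∞ => ψ t.toReal) = (fun t : ℝ => ψ (max t 0)) ∘ ENNReal.toReal := by
      ext t; simp
    rw [h2]
    exact h1.comp ENNReal.measurable_toReal
  have hΨ1 : ∀ (k : ℕ) (t : ℝ≥0∞), G k ≤ t →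
      1 ≤ ENNReal.ofReal (a k) ^ ((n : ℝ) - 1) * Ψ t := by
    intro k t ht
    rw [ENNReal.ofReal_rpow_of_pos (ha0 k)]
    have hpos : 0 < a k ^ ((n : ℝ) - 1) := Real.rpow_pos_of_pos (ha0 k) _
    by_cases htt : t = ∞
    · simp only [hΨ, if_pos htt]
      rw [ENNReal.mul_top (by simpa using hpos)]
      exact le_top
    · simp only [hΨ, if_neg htt]
      rw [← ENNReal.ofReal_mul hpos.le, ← ENNReal.ofReal_one]
      refine ENNReal.ofReal_le_ofReal (hψ k _ ?_)
      have := ENNReal.toReal_mono htt ht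
      simpa using this
  intro z hz
  obtain ⟨x₀, y₀, rfl⟩ := exists_joinPt_eq z
  obtain ⟨ε, hε, hεΩ⟩ := Metric.isOpen_iff.1 hΩ_open _ hz
  obtain ⟨r, hrε⟩ : ∃ r, ε = 5 * r := ⟨ε / 5, by ring⟩
  have hr : 0 < r := by linarith
  have hΩ' : closedBall (joinPt x₀ y₀) (2 * (2 * r)) ⊆ Ω :=
    (closedBall_subset_ball (by linarith)).trans hεΩ
  have h2r : 0 < 2 * r := by linarith
  have hsx : ∀ y ∈ ball y₀ (2 * r), closedBall x₀ (2 * r) ⊆ sectionAtSnd Ω y :=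
    fun y hy x hx => hΩ' (dist_joinPt_lt h2r hx (mem_ball.1 hy).le).le
  have hsy : ∀ x ∈ ball x₀ (2 * r), closedBall y₀ (2 * r) ⊆ sectionAtFst Ω x :=
    fun x hx y hy => hΩ' (dist_joinPt_lt h2r (mem_ball.1 hx).le hy).le
  have hvm : AEMeasurable (truncShift 0 u)
      (volume.restrict (ball (joinPt x₀ y₀) (2 * (2 * r)))) :=
    (hu_meas.mono_set (ball_subset_closedBall.trans hΩ')).truncShift 0
  obtain ⟨B, hB⟩ := exists_bound_of_separately_le_mean
    (v := fun x y => truncShift 0 u (joinPt x y)) (x₀ := x₀) (y₀ := y₀) hn hmn hr hK'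
    (aemeasurable_comp_joinPt h2r hvm)
    (fun y hy => ((ha y).measurable.mono_set (ball_subset_closedBall.trans (hsx y hy))).truncShift 0)
    (fun x hx => ((hb x).measurable.mono_set (ball_subset_closedBall.trans (hsy x hx))).truncShift 0)
    (fun y hy => (ha y).lintegral_truncShift_ne_top (hsx y hy))
    (fun x hx => (hb x).lintegral_truncShift_ne_top (hsy x hx))
    (fun y hy x t ht h => (ha y).le_mean x t ht
      (h.trans (ball_subset_closedBall.trans (hsx y hy))) 0 le_rfl)
    (fun x hx y t ht h => (hb x).le_mean y t ht
      (h.trans (ball_subset_closedBall.trans (hsy x hx))) 0 le_rfl)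
    hG0 hGm hG2 hGC haa ha0 hsum hΨm hΨ1 (by
      refine ne_top_of_le_ne_top ?_ (lintegral_joinPt_le h2r (hΨm.comp_aemeasurable hvm))
      have h1 := (hc5.integrableOn_compact_subset hΩ' (isCompact_closedBall _ _)).mono_set
        ball_subset_closedBall
      refine ne_top_of_le_ne_top (Integrable.lintegral_lt_top h1).ne (le_of_eq ?_)
      refine setLIntegral_congr_fun measurableSet_ball fun w hw => ?_
      simp only [Function.comp, hΨ,
        truncShift_zero_eq_ofReal (hu_top w (hΩ' (ball_subset_closedBall hw)))]
      rw [if_neg ENNReal.ofReal_ne_top, ENNReal.toReal_ofReal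
        (posPartReal_nonneg _ _)])
  have hbd : ∀ w ∈ ball (joinPt x₀ y₀) r, ‖posPartReal u w‖ ≤ B := by
    intro w hw
    obtain ⟨x, y, rfl⟩ := exists_joinPt_eq w
    have hwΩ : joinPt x y ∈ Ω := hΩ' (ball_subset_closedBall (ball_subset_ball (by linarith) hw))
    rw [mem_ball, dist_joinPt] at hw
    have hx : dist x x₀ < r := lt_of_le_of_lt (Real.le_sqrt_of_sq_le (by
      have := sq_nonneg (dist y y₀); linarith)) hw
    have hy : dist y y₀ < r := lt_of_le_of_lt (Real.le_sqrt_of_sq_le (by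
      have := sq_nonneg (dist x x₀); linarith)) hw
    have h := hB x hx y hy
    simp only [truncShift_zero_eq_ofReal (hu_top _ hwΩ)] at h
    rw [Real.norm_of_nonneg (posPartReal_nonneg _ _)]
    rw [ENNReal.ofReal_le_iff_le_toReal ENNReal.coe_ne_top] at h
    simpa using h
  refine ⟨ball (joinPt x₀ y₀) r, mem_nhdsWithin_of_mem_nhds (ball_mem_nhds _ hr), ?_⟩
  have hmeas : AEMeasurable (posPartReal u) (volume.restrict (ball (joinPt x₀ y₀) r)) :=
    aemeasurable_posPartReal (hu_meas.mono_set
      ((ball_subset_ball (by linarith)).trans (ball_subset_closedBall.trans hΩ')))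
  have : IsFiniteMeasure (volume.restrict (ball (joinPt x₀ y₀) r)) :=
    isFiniteMeasure_restrict.2 measure_ball_lt_top.ne
  exact Integrable.of_bound hmeas.aestronglyMeasurable B
    ((ae_restrict_mem measurableSet_ball).mono fun w hw => hbd w hw)

theorem theorem4p2 (m n : ℕ) (hn : 2 ≤ n) (hmn : n ≤ m)
    (Ω : Set (EuclideanSpace ℝ (Fin (m + n)))) (hΩ_open : IsOpen Ω) (hΩ_conn : IsConnected Ω)
    (K : ℝ) (hK : 1 ≤ K)
    (u : EuclideanSpace ℝ (Fin (m + n)) → EReal)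
    (hu_top : ∀ z ∈ Ω, u z < ⊤)
    (hu_meas : AEMeasurable u (volume.restrict Ω))
    (ha : ∀ y : EuclideanSpace ℝ (Fin n),
      IsQuasiNearlySubharmonicWith K (fun x => u (joinPt x y)) (sectionAtSnd Ω y))
    (hb : ∀ x : EuclideanSpace ℝ (Fin m),
      IsQuasiNearlySubharmonicWith K (fun y => u (joinPt x y)) (sectionAtFst Ω x))
    (φ ψ : ℝ → ℝ)
    (hφ_maps : MapsTo φ (Ici 0) (Ici 0)) (hψ_maps : MapsTo ψ (Ici 0) (Ici 0))
    (hφ_mono : MonotoneOn φ (Ici 0)) (hψ_mono : MonotoneOn ψ (Ici 0))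
    (s₀ s₁ : ℕ) (hs : s₀ < s₁)
    (hc1φ : InverseDefinedOn φ (Ici (min (φ ((s₁ : ℝ) - s₀)) (ψ ((s₁ : ℝ) - s₀)))))
    (hc1ψ : InverseDefinedOn ψ (Ici (min (φ ((s₁ : ℝ) - s₀)) (ψ ((s₁ : ℝ) - s₀)))))
    (hc2 : ∀ s : ℝ, (s₁ : ℝ) ≤ s → 2 * K * invComp ψ φ (s - s₀) ≤ invComp ψ φ s)
    (hc3 : ∃ C : ℝ, ∀ s : ℝ, (s₁ : ℝ) + 1 ≤ s → |invComp ψ φ (s + 1) / invComp ψ φ s| ≤ C)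
    (hc4 : IntegrableOn
      (fun s : ℝ => s ^ (((n : ℝ) - 1) / ((m : ℝ) - 1)) / (φ (s - s₀)) ^ (1 / ((m : ℝ) - 1)))
      (Ioi (s₁ : ℝ)) volume)
    (hc5 : LocallyIntegrableOn (fun z => ψ (posPartReal u z)) Ω volume) :
    IsQuasiNearlySubharmonic u Ω := by
  obtain ⟨K', hK', hmean⟩ := exists_mean_le_of_separately hu_meas ha hb
  exact ⟨K', hK', hu_top, hu_meas,
    locallyIntegrableOn_posPartReal_of_separately hn hmn hΩ_open hK hu_top hu_meas ha hb
      hφ_maps hφ_mono hψ_mono hs hc1φ hc1ψ hc2 hc3 hc4 hc5, hmean⟩
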